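/- Let $(R,\mathfrak m,k)$ be a commutative Noetherian local ring of Krull dimension $d\ge 1$ and of depth $0$. Let $\lambda$ denote length of $R$-modules, let $H^0_{\mathfrak m}(R)=\bigcup_n (0:_R\mathfrak m^n)$ and $\operatorname{Soc}(R)=(0:_R\mathfrak m)$, and set $$t=\lambda(H^0_{\mathfrak m}(R))-\lambda(\operatorname{Soc}(R)),\qquad l=\dim_k \operatorname{Soc}(R).$$ Let $M\neq 0$ be an $R$-module of finite length, let $G_\bullet$ be a minimal free resolution of $M$ by finitely generated free modules, and for $i>0$ let $\operatorname{Syz}_i M$ be the image of $G_i\to G_{i-1}$. 1. If $d=1$ and $l>t$, then $\lambda(\operatorname{Syz}_i M)=\infty$ for all $i>0$ with $i\neq 2$. 2. If $d\ge 2$ and $l\ge t$, then $\lambda(\operatorname{Syz}_i M)=\infty$ for all $i>0$. -/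

import Mathlib

open IsLocalRing

/-- The depth of a local ring: the supremum of the lengths of the regular sequences contained in
the maximal ideal. -/
noncomputable def localDepth (R : Type*) [CommRing R] [IsLocalRing R] : ℕ∞ :=
  ⨆ (rs : List R) (_ : RingTheory.Sequence.IsRegular R rs ∧ ∀ r ∈ rs, r ∈ maximalIdeal R),
    (rs.length : ℕ∞)

/-- The socle `(0 :_R 𝔪)` of a local ring `(R, 𝔪)`. As the `𝔪`-torsion of `R` it carries Mathlib's
`R ⧸ 𝔪`-vector space structure. -/
abbrev localSocle (R : Type*) [CommRing R] [IsLocalRing R] : Submodule R R :=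
  Submodule.torsionBySet R R (maximalIdeal R : Set R)

/-- The zeroth local cohomology `H⁰_𝔪(R) = ⋃ n, (0 :_R 𝔪 ^ n)` of a local ring `(R, 𝔪)`, as an
`R`-submodule of `R`. -/
abbrev localH0 (R : Type*) [CommRing R] [IsLocalRing R] : Submodule R R :=
  (maximalIdeal R).primaryComponent R

theorem localSocle_le_localH0 (R : Type*) [CommRing R] [IsLocalRing R] :
    localSocle R ≤ localH0 R := by
  intro x hx
  rw [Ideal.primaryComponent_mem]
  exact ⟨1, by simpa using hx⟩

/-- The number `t = λ(H⁰_𝔪(R)) - λ(Soc R)`. For a Noetherian local ring both lengths are finite, and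
the second is at most the first, so that the subtraction is the usual one. -/
noncomputable def socleDefect (R : Type*) [CommRing R] [IsLocalRing R] : ℕ∞ :=
  Module.length R (localH0 R) - Module.length R (localSocle R)

/-- The dimension of `Soc R` as a vector space over the residue field `R ⧸ 𝔪`. -/
noncomputable def socleDim (R : Type*) [CommRing R] [IsLocalRing R] : ℕ :=
  Module.finrank (R ⧸ maximalIdeal R) (localSocle R)

/-- A minimal free resolution `⋯ → R^{b₂} → R^{b₁} → R^{b₀} → M → 0` of a module `M` over a local
ring `(R, 𝔪)`. The map `d i` goes from the term of index `i + 1` to the term of index `i`; minimality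
says that all matrix entries of the `d i` lie in `𝔪`. -/
structure MinimalFreeResolution (R : Type*) [CommRing R] [IsLocalRing R]
    (M : Type*) [AddCommGroup M] [Module R M] where
  /-- The Betti numbers. -/
  b : ℕ → ℕ
  /-- The differentials. -/
  d : ∀ i, (Fin (b (i + 1)) → R) →ₗ[R] (Fin (b i) → R)
  /-- The augmentation. -/
  ε : (Fin (b 0) → R) →ₗ[R] M
  surjective_ε : Function.Surjective ε
  exact_zero : Function.Exact (d 0) ε
  exact_succ : ∀ i, Function.Exact (d (i + 1)) (d i)
  minimal : ∀ i x j, d i x j ∈ maximalIdeal R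

namespace MinimalFreeResolution

variable {R : Type*} [CommRing R] [IsLocalRing R] {M : Type*} [AddCommGroup M] [Module R M]

/-- The `i`-th syzygy module `Syz_i M`, for `i > 0`: the image of `G_i → G_{i-1}` in a minimal free
resolution `G` of `M`. (The value at `i = 0` is not meaningful.) -/
def syz (G : MinimalFreeResolution R M) (i : ℕ) : Submodule R (Fin (G.b (i - 1)) → R) :=
  LinearMap.range (G.d (i - 1))

/-- Every finitely generated module is covered minimally by a free module. -/
theorem exists_cover (N : Type*) [AddCommGroup N] [Module R N] [Module.Finite R N] :
    ∃ (n : ℕ) (f : (Fin n → R) →ₗ[R] N), Function.Surjective f ∧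
      ∀ x, f x = 0 → ∀ j, x j ∈ maximalIdeal R := by
  classical
  have hex : ∃ n, ∃ g : Fin n → N, Function.Surjective (Fintype.linearCombination R g) := by
    obtain ⟨n, g, hg⟩ := Module.Finite.exists_fin (R := R) (M := N)
    refine ⟨n, g, ?_⟩
    rw [← LinearMap.range_eq_top, Fintype.range_linearCombination, hg]
  obtain ⟨g, hg⟩ := Nat.find_spec hex
  refine ⟨Nat.find hex, Fintype.linearCombination R g, hg, ?_⟩
  have hmin := fun k (hk : k < Nat.find hex) => Nat.find_min hex hk
  revert g hmin
  generalize Nat.find hex = n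
  intro g hg hmin x hx j
  by_contra hj
  have hu : IsUnit (x j) := by simpa using hj
  obtain ⟨u, hu⟩ := hu
  cases n with
  | zero => exact j.elim0
  | succ k =>
    refine hmin k (Nat.lt_succ_self k) ⟨g ∘ j.succAbove, fun y => ?_⟩
    obtain ⟨v, rfl⟩ := hg y
    refine ⟨fun i => v (j.succAbove i) - v j * ↑u⁻¹ * x (j.succAbove i), ?_⟩
    have h0 : Fintype.linearCombination R g (v - (v j * ↑u⁻¹) • x) =
        Fintype.linearCombination R g v := by
      rw [map_sub, map_smul, hx, smul_zero, sub_zero]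
    rw [← h0, Fintype.linearCombination_apply, Fintype.linearCombination_apply,
      Fin.sum_univ_succAbove _ j]
    simp [← hu]

/-- Over a Noetherian local ring every finitely generated module has a minimal free resolution. -/
theorem nonempty_of_finite [IsNoetherianRing R] [Module.Finite R M] :
    Nonempty (MinimalFreeResolution R M) := by
  obtain ⟨n₀, f₀, hf₀, hm₀⟩ := exists_cover (R := R) M
  have step : ∀ s : Σ n : ℕ, Submodule R (Fin n → R), ∃ (n : ℕ) (f : (Fin n → R) →ₗ[R] s.2),
      Function.Surjective f ∧ ∀ x, f x = 0 → ∀ j, x j ∈ maximalIdeal R :=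
    fun s => exists_cover (R := R) s.2
  choose n f hf hm using step
  let s : ℕ → Σ n : ℕ, Submodule R (Fin n → R) := fun i =>
    Nat.rec ⟨n₀, LinearMap.ker f₀⟩ (fun _ t => ⟨n t, LinearMap.ker (f t)⟩) i
  have hs : ∀ i, ∀ x ∈ (s i).2, ∀ j, x j ∈ maximalIdeal R := by
    intro i
    cases i with
    | zero => exact fun x hx => hm₀ x hx
    | succ i => exact fun x hx => hm (s i) x hx
  refine ⟨{ b := fun i => (s i).1, d := fun i => (s i).2.subtype ∘ₗ f (s i), ε := f₀,
            surjective_ε := hf₀, exact_zero := ?_, exact_succ := ?_, minimal := ?_ }⟩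
  · intro y
    refine ⟨fun hy => ?_, ?_⟩
    · obtain ⟨z, hz⟩ := hf (s 0) ⟨y, hy⟩
      exact ⟨z, congrArg Subtype.val hz⟩
    · rintro ⟨z, rfl⟩
      exact (f (s 0) z).2
  · intro i y
    refine ⟨fun hy => ?_, ?_⟩
    · have hy' : f (s i) y = 0 := Subtype.ext hy
      obtain ⟨z, hz⟩ := hf (s (i + 1)) ⟨y, hy'⟩
      exact ⟨z, congrArg Subtype.val hz⟩
    · rintro ⟨z, rfl⟩
      exact congrArg Subtype.val (f (s (i + 1)) z).2
  · intro i x j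
    exact hs i _ (f (s i) x).2 j

end MinimalFreeResolution

/-! ### Linear maps of free modules localized at a prime. -/

section Localization

variable {R : Type*} [CommRing R]

/-! Suppose `Syz_{i+3} M`, the kernel of `f = d (i + 1)`, has finite length. By minimality `f` kills
the socle of its source, and the socle of its target lies in `ker (d i) = range f`, with preimages
in `H⁰_𝔪`. Counting lengths in `H⁰_𝔪(R)^{b_{i+2}}` gives `b_{i+1} l ≤ b_{i+2} t`
(`b_mul_socleDim_le`). At a nonmaximal prime `f` becomes injective, so `b_{i+2} ≤ b_{i+1}`; hence `l
≤ t`, which settles part 1 from index 3 on. `Syz_1` is infinite because `R` is.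

If `l ≥ t`, both inequalities force `b_{i+1} = b_{i+2}`. Then `det f` is a nonzerodivisor at every
nonmaximal prime and kills `coker f ≅ Syz_{i+1} M`, a submodule of a free module; so `Syz_{i+1} M`
also has finite length. This descends to `Syz_1` or `Syz_2`. If `Syz_2` is of finite length, `d 0`
is a square matrix, invertible exactly off `𝔪`, so `𝔪` is minimal over its determinant and Krull's
principal ideal theorem gives `dim R ≤ 1`. -/

theorem exists_notMem_smul_eq_zero_of_algebraMap_eq_zero (p : Ideal R) [p.IsPrime] {ι : Type*}
    [Finite ι] (x : ι → R) (hx : ∀ j, algebraMap R (Localization.AtPrime p) (x j) = 0) :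
    ∃ s ∉ p, s • x = 0 := by
  cases nonempty_fintype ι
  have h j : ∃ s : p.primeCompl, (s : R) * x j = 0 :=
    (IsLocalization.map_eq_zero_iff p.primeCompl _ _).1 (hx j)
  choose s hs using h
  refine ⟨∏ j, (s j : R), p.primeCompl.prod_mem fun j _ => (s j).2, funext fun j => ?_⟩
  obtain ⟨c, hc⟩ := Finset.dvd_prod_of_mem (fun j => (s j : R)) (Finset.mem_univ j)
  simp only [Pi.smul_apply, smul_eq_mul, Pi.zero_apply]
  rw [hc, mul_right_comm, hs, zero_mul]

/-- A linear map between free modules whose kernel vanishes at `p` has injective localization. -/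
theorem mulVec_localization_injective (p : Ideal R) [p.IsPrime] {m n : Type*} [Fintype m]
    [Fintype n] [DecidableEq n] (f : (n → R) →ₗ[R] (m → R))
    (hf : ∀ x, f x = 0 → ∃ s ∉ p, s • x = 0) :
    Function.Injective
      ((LinearMap.toMatrix' f).map (algebraMap R (Localization.AtPrime p))).mulVec := by
  set S := Localization.AtPrime p
  set A := LinearMap.toMatrix' f
  refine (injective_iff_map_eq_zero (A.map (algebraMap R S)).mulVecLin).2 fun v hv => ?_
  obtain ⟨s, hs⟩ := IsLocalization.exist_integer_multiples_of_finite p.primeCompl v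
  choose w hw using hs
  have hsu : IsUnit (algebraMap R S s) := IsLocalization.map_units S s
  have hw' : (fun j => algebraMap R S (w j)) = algebraMap R S s • v := by
    funext j
    rw [hw j, Pi.smul_apply, smul_eq_mul, Algebra.smul_def]
  have hAw (j) : algebraMap R S (f w j) = 0 := by
    have h1 : (A.map (algebraMap R S)).mulVec (fun j => algebraMap R S (w j)) j = 0 := by
      rw [hw', Matrix.mulVec_smul]
      have : (A.map (algebraMap R S)).mulVec v = 0 := hv
      rw [this, smul_zero, Pi.zero_apply]
    rw [← LinearMap.toMatrix'_mulVec, ← h1]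
    exact RingHom.map_mulVec (algebraMap R S) A w j
  obtain ⟨u, hu, hu0⟩ := exists_notMem_smul_eq_zero_of_algebraMap_eq_zero p (f w) hAw
  obtain ⟨u', hu', hu0'⟩ := hf (u • w) (by rw [map_smul, hu0])
  funext j
  have h2 : algebraMap R S (w j) = 0 := by
    refine (IsLocalization.map_eq_zero_iff p.primeCompl _ _).2
      ⟨⟨u' * u, p.primeCompl.mul_mem hu' hu⟩, ?_⟩
    simpa [mul_assoc] using congrFun hu0' j
  have h3 := congrFun hw' j
  rw [h2, Pi.smul_apply, smul_eq_mul, eq_comm, hsu.mul_right_eq_zero] at h3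
  exact h3

theorem le_of_ker_locally_zero (p : Ideal R) [p.IsPrime] {a b : ℕ}
    (f : (Fin a → R) →ₗ[R] (Fin b → R)) (hf : ∀ x, f x = 0 → ∃ s ∉ p, s • x = 0) : a ≤ b :=
  le_of_fin_injective _
    ((LinearMap.toMatrix' f).map (algebraMap R (Localization.AtPrime p))).mulVecLin
    (mulVec_localization_injective p f hf)

/-- An injective square matrix over any commutative ring has a nonzerodivisor as determinant; this
is applied over the localization at `p`. -/
theorem exists_notMem_mul_eq_zero_of_det_mul_eq_zero (p : Ideal R) [p.IsPrime] {n : Type*}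
    [Fintype n] [DecidableEq n] (f : (n → R) →ₗ[R] (n → R))
    (hf : ∀ x, f x = 0 → ∃ s ∉ p, s • x = 0) {r : R} (hr : LinearMap.det f * r = 0) :
    ∃ s ∉ p, s * r = 0 := by
  have h := Matrix.nonsingular_iff_det_mem_nonZeroDivisors.1 <|
    Matrix.Nonsingular.of_linearIndependent_col <|
      Matrix.mulVec_injective_iff.1 (mulVec_localization_injective p f hf)
  rw [← RingHom.mapMatrix_apply, ← RingHom.map_det, LinearMap.det_toMatrix'] at h
  have h2 := (mem_nonZeroDivisors_iff.1 h).1 (algebraMap R _ r) (by rw [← map_mul, hr, map_zero])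
  obtain ⟨s, hs⟩ := (IsLocalization.map_eq_zero_iff p.primeCompl _ _).1 h2
  exact ⟨s, s.2, hs⟩

theorem det_smul_mem_range {n : Type*} [Fintype n] [DecidableEq n]
    (f : (n → R) →ₗ[R] (n → R)) (y : n → R) :
    LinearMap.det f • y ∈ LinearMap.range f := by
  refine ⟨(LinearMap.toMatrix' f).adjugate.mulVec y, ?_⟩
  rw [← LinearMap.toMatrix'_mulVec, Matrix.mulVec_mulVec, Matrix.mul_adjugate,
    Matrix.smul_mulVec, Matrix.one_mulVec, LinearMap.det_toMatrix']

end Localization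

/-! ### Finite length, powers of the maximal ideal, and the punctured spectrum. -/

section FiniteLength

variable {R : Type*} [CommRing R] [IsLocalRing R]

/-- Each simple factor of a composition series is killed by `𝔪` and costs one power. -/
theorem IsFiniteLength.exists_pow_le_annihilator {N : Type*} [AddCommGroup N] [Module R N]
    (h : IsFiniteLength R N) : ∃ k, maximalIdeal R ^ k ≤ Module.annihilator R N := by
  induction h with
  | of_subsingleton => exact ⟨0, by rw [Module.annihilator_eq_top_iff.2 ‹_›]; exact le_top⟩
  | @of_simple_quotient N _ _ K _ _ ih =>
    obtain ⟨k, hk⟩ := ih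
    have hm : Module.annihilator R (N ⧸ K) = maximalIdeal R :=
      IsLocalRing.eq_maximalIdeal IsSimpleModule.annihilator_isMaximal
    refine ⟨k + 1, ?_⟩
    rw [pow_succ, Ideal.mul_le]
    intro r hr s hs
    rw [Module.mem_annihilator]
    intro x
    have hsx : s • x ∈ K := by
      rw [← Submodule.Quotient.mk_eq_zero, Submodule.Quotient.mk_smul]
      exact Module.mem_annihilator.1 (hm ▸ hs) _
    rw [mul_smul]
    exact congrArg Subtype.val (Module.mem_annihilator.1 (hk hr) ⟨s • x, hsx⟩)

/-- Induction through `𝔪N ⊆ N`: the quotient is a finite-dimensional vector space over the residue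
field, and `𝔪N` needs one power less. -/
theorem isFiniteLength_of_pow_le_annihilator [IsNoetherianRing R] (k : ℕ) :
    ∀ {N : Type*} [AddCommGroup N] [Module R N] [Module.Finite R N],
      maximalIdeal R ^ k ≤ Module.annihilator R N → IsFiniteLength R N := by
  induction k with
  | zero =>
    intro N _ _ _ h
    have : Subsingleton N := by
      rw [← Module.annihilator_eq_top_iff (R := R)]
      simpa using h
    exact .of_subsingleton
  | succ k ih =>
    intro N _ _ _ h
    set K : Submodule R N := maximalIdeal R • ⊤
    have hK : IsFiniteLength R K := by
      refine ih fun r hr => Module.mem_annihilator.2 fun ⟨x, hx⟩ => Subtype.ext ?_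
      change r • x = 0
      induction hx using Submodule.smul_induction_on' with
      | smul s hs y _ =>
        rw [← mul_smul]
        exact Module.mem_annihilator.1 (h (pow_succ (maximalIdeal R) k ▸ Ideal.mul_mem_mul hr hs)) y
      | add x _ y _ hx hy => rw [smul_add, hx, hy, add_zero]
    rw [← Module.length_ne_top_iff] at hK ⊢
    rw [Module.length_eq_add_of_exact K.subtype K.mkQ K.subtype_injective K.mkQ_surjective
      (LinearMap.exact_subtype_mkQ K)]
    refine WithTop.add_ne_top.2 ⟨hK, ?_⟩
    let := Ideal.Quotient.field (maximalIdeal R)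
    have : Module.Finite (R ⧸ maximalIdeal R) (N ⧸ K) :=
      Module.Finite.of_restrictScalars_finite R _ _
    rw [Module.length_eq_of_surjective (R := R ⧸ maximalIdeal R) Ideal.Quotient.mk_surjective,
      Module.length_eq_finrank]
    exact ENat.natCast_ne_top _

/-- A finitely generated module over a Noetherian local ring that vanishes on the punctured spectrum
has finite length. -/
theorem isFiniteLength_of_locally_zero [IsNoetherianRing R] {N : Type*} [AddCommGroup N]
    [Module R N] [Module.Finite R N]
    (h : ∀ p : Ideal R, p.IsPrime → p ≠ maximalIdeal R → ∀ x : N, ∃ s ∉ p, s • x = 0) :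
    IsFiniteLength R N := by
  have hrad : maximalIdeal R ≤ (Module.annihilator R N).radical := by
    rw [Ideal.radical_eq_sInf]
    refine le_sInf fun p ⟨hp, hprime⟩ => ?_
    by_contra hne
    have hmem : (⟨p, hprime⟩ : PrimeSpectrum R) ∈ Module.support R N :=
      Module.mem_support_iff_of_finite.2 hp
    obtain ⟨x, hx⟩ := Module.mem_support_iff_exists_annihilator.1 hmem
    obtain ⟨s, hs, hs0⟩ := h p hprime (fun e => hne e.ge) x
    exact hs (hx ((Submodule.mem_annihilator_span_singleton _ _).2 hs0))
  obtain ⟨k, hk⟩ := Ideal.exists_pow_le_of_le_radical_of_fg hrad (IsNoetherian.noetherian _)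
  exact isFiniteLength_of_pow_le_annihilator k hk

theorem exists_mem_maximalIdeal_notMem {p : Ideal R} [hp : p.IsPrime] (hne : p ≠ maximalIdeal R) :
    ∃ x ∈ maximalIdeal R, x ∉ p :=
  SetLike.not_le_iff_exists.1 fun h =>
    hne ((IsLocalRing.le_maximalIdeal hp.ne_top).antisymm h)

theorem IsFiniteLength.exists_notMem_smul_eq_zero {N : Type*} [AddCommGroup N] [Module R N]
    (h : IsFiniteLength R N) {p : Ideal R} [hp : p.IsPrime] (hne : p ≠ maximalIdeal R) :
    ∃ s ∉ p, ∀ x : N, s • x = 0 := by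
  obtain ⟨k, hk⟩ := h.exists_pow_le_annihilator
  obtain ⟨x, hx, hxp⟩ := exists_mem_maximalIdeal_notMem hne
  exact ⟨x ^ k, fun hmem => hxp (hp.mem_of_pow_mem k hmem),
    fun y => Module.mem_annihilator.1 (hk (Ideal.pow_mem_pow hx k)) y⟩

theorem exists_isPrime_ne_maximalIdeal (h : 1 ≤ ringKrullDim R) :
    ∃ p : Ideal R, p.IsPrime ∧ p ≠ maximalIdeal R := by
  by_contra! hcon
  have : Ring.KrullDimLE 0 R := Ring.krullDimLE_zero_iff.2 fun p hp =>
    hcon p hp ▸ maximalIdeal.isMaximal R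
  have h0 : ringKrullDim R ≤ 0 := (Order.krullDimLE_iff 0 _).1 this
  exact absurd (h.trans h0) (by decide)

theorem not_isFiniteLength_self (h : 1 ≤ ringKrullDim R) : ¬ IsFiniteLength R R := by
  intro hfl
  obtain ⟨p, hp, hne⟩ := exists_isPrime_ne_maximalIdeal h
  obtain ⟨s, hs, h0⟩ := hfl.exists_notMem_smul_eq_zero hne
  have hs0 : s = 0 := by simpa using h0 1
  exact hs (hs0 ▸ p.zero_mem)

end FiniteLength

/-! ### Socle, depth zero and the length count. -/

section Socle

variable {R : Type*} [CommRing R] [IsLocalRing R]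

theorem length_localSocle [IsNoetherianRing R] :
    Module.length R (localSocle R) = socleDim R := by
  let := Ideal.Quotient.field (maximalIdeal R)
  have : Module.Finite (R ⧸ maximalIdeal R) (localSocle R) :=
    Module.Finite.of_restrictScalars_finite R _ _
  rw [Module.length_eq_of_surjective (R := R ⧸ maximalIdeal R) Ideal.Quotient.mk_surjective,
    Module.length_eq_finrank]
  rfl

theorem length_localH0_eq [IsNoetherianRing R] :
    Module.length R (localH0 R) = socleDefect R + socleDim R := by
  rw [socleDefect, length_localSocle, tsub_add_cancel_of_le]
  rw [← length_localSocle]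
  exact Module.length_le_of_injective (Submodule.inclusion (localSocle_le_localH0 R))
    (Submodule.inclusion_injective _)

/-- Depth zero means that `𝔪` consists of zerodivisors; over a Noetherian ring such an ideal has a
nonzero annihilator. -/
theorem exists_mem_localSocle_ne_zero [IsNoetherianRing R] (h : localDepth R = 0) :
    ∃ x ∈ localSocle R, x ≠ 0 := by
  have hdisj : Disjoint (maximalIdeal R : Set R) (nonZeroDivisors R) := by
    rw [Set.disjoint_left]
    intro r hr hnz
    have hreg : RingTheory.Sequence.IsRegular R [r] := by
      rw [RingTheory.Sequence.isRegular_iff]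
      refine ⟨(RingTheory.Sequence.isWeaklyRegular_singleton_iff R r).2 ?_, ?_⟩
      · intro a b hab
        exact (mem_nonZeroDivisors_iff_left.1 hnz (a - b) (by
          simpa [mul_sub, sub_eq_zero] using hab)) |> sub_eq_zero.1
      · intro htop
        have h1 : (1 : R) ∈ Ideal.ofList [r] • (⊤ : Submodule R R) := htop ▸ Submodule.mem_top
        simp only [smul_eq_mul, Ideal.mul_top, Ideal.ofList_singleton,
          Ideal.mem_span_singleton] at h1
        exact (mem_maximalIdeal r).1 hr (isUnit_of_dvd_one h1)
    have h1 : ((1 : ℕ) : ℕ∞) ≤ localDepth R :=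
      le_iSup₂_of_le [r] ⟨hreg, by simpa using hr⟩ (by simp)
    rw [h] at h1
    exact absurd h1 (by decide)
  obtain ⟨_, x, hx, hx0⟩ :=
    SetLike.lt_iff_le_and_exists.1 (Ideal.bot_lt_annihilator_of_disjoint_nonZeroDivisors hdisj)
  refine ⟨x, (Submodule.mem_torsionBySet_iff _ _).2 fun r => ?_, by simpa using hx0⟩
  have := Module.mem_annihilator.1 hx ⟨r, r.2⟩
  simpa [mul_comm] using congrArg Subtype.val this

theorem socleDim_pos [IsNoetherianRing R] (h : localDepth R = 0) : 0 < socleDim R := by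
  obtain ⟨x, hx, hx0⟩ := exists_mem_localSocle_ne_zero h
  have : Nontrivial (localSocle R) := ⟨⟨x, hx⟩, 0, fun e => hx0 (congrArg Subtype.val e)⟩
  have h := Module.length_pos (R := R) (M := localSocle R)
  rw [length_localSocle] at h
  exact_mod_cast h

theorem map_eq_zero_of_mem_localSocle {a b : ℕ} (f : (Fin a → R) →ₗ[R] (Fin b → R))
    (hf : ∀ x j, f x j ∈ maximalIdeal R) {x : Fin a → R} (hx : ∀ j, x j ∈ localSocle R) :
    f x = 0 := by
  rw [LinearMap.pi_apply_eq_sum_univ f x]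
  refine Finset.sum_eq_zero fun i _ => funext fun j => ?_
  have := (Submodule.mem_torsionBySet_iff _ _).1 (hx i) ⟨_, hf (fun j => if i = j then 1 else 0) j⟩
  rw [Pi.smul_apply, smul_eq_mul, mul_comm]
  exact this

/-- If a linear map of free modules has kernel of finite length containing the socle and its image
contains the socle, then the socles of source and target fit into `H⁰_𝔪` of the source. -/
theorem length_localSocle_mul_le {a b : ℕ} (f : (Fin a → R) →ₗ[R] (Fin b → R))
    (hker : IsFiniteLength R (LinearMap.ker f))
    (hsrc : ∀ x : Fin a → R, (∀ j, x j ∈ localSocle R) → f x = 0)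
    (htgt : ∀ y : Fin b → R, (∀ j, y j ∈ localSocle R) → y ∈ LinearMap.range f) :
    a * Module.length R (localSocle R) + b * Module.length R (localSocle R) ≤
      a * Module.length R (localH0 R) := by
  -- Length is additive along the restriction of `f` to `H⁰_𝔪(R)^a`: its kernel contains `Soc(R)^a`
  -- and its image contains `Soc(R)^b`.
  let φ : (Fin a → localH0 R) →ₗ[R] (Fin b → R) := f ∘ₗ (localH0 R).subtype.compLeft (Fin a)
  have hlen (n : ℕ) (N : Submodule R R) :
      n * Module.length R N = Module.length R (Fin n → N) := by
    rw [Module.length_pi]; simp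
  rw [hlen, hlen, hlen, Module.length_eq_add_of_exact (LinearMap.ker φ).subtype φ.rangeRestrict
    (Submodule.subtype_injective _) φ.surjective_rangeRestrict
    (by rw [← φ.ker_rangeRestrict]; exact LinearMap.exact_subtype_ker_map _)]
  refine add_le_add ?_ ?_
  · refine Module.length_le_of_injective
      (((Submodule.inclusion (localSocle_le_localH0 R)).compLeft (Fin a)).codRestrict
        (LinearMap.ker φ) fun x => hsrc _ fun j => (x j).2) fun x y hxy => ?_
    funext j
    exact Subtype.ext (congrArg (fun z => ((z.1 j : localH0 R) : R)) hxy)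
  · obtain ⟨k, hk⟩ := hker.exists_pow_le_annihilator
    refine Module.length_le_of_injective
      (((localSocle R).subtype.compLeft (Fin b)).codRestrict (LinearMap.range φ) fun y => ?_)
      fun x y hxy => ?_
    · obtain ⟨x, hx⟩ := htgt (fun j => y j) fun j => (y j).2
      -- One factor from `𝔪` kills the socle element `f x`, moving `x` into `ker f`; then `𝔪 ^ k`
      -- kills it, hence the exponent `k + 1`.
      have hxH j : x j ∈ localH0 R := by
        refine (Ideal.primaryComponent_mem _ _ _).2
          ⟨k + 1, (Submodule.mem_torsionBySet_iff _ _).2 fun ⟨r, hr⟩ => ?_⟩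
        have hle : maximalIdeal R ^ (k + 1) ≤ LinearMap.ker (LinearMap.toSpanSingleton R _ x) := by
          rw [pow_succ, Ideal.mul_le]
          intro u hu v hv
          have hvx : v • x ∈ LinearMap.ker f := by
            rw [LinearMap.mem_ker, map_smul, hx]
            funext i
            exact (Submodule.mem_torsionBySet_iff _ _).1 (y i).2 ⟨v, hv⟩
          rw [LinearMap.mem_ker, LinearMap.toSpanSingleton_apply, mul_smul]
          exact congrArg Subtype.val (Module.mem_annihilator.1 (hk hu) ⟨v • x, hvx⟩)
        exact congrFun (hle hr) j
      exact ⟨fun j => ⟨x j, hxH j⟩, hx⟩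
    · funext j
      exact Subtype.ext (congrArg (fun z => z.1 j) hxy)

end Socle

/-! ### Ranks and determinants on the punctured spectrum. -/

section PuncturedSpectrum

variable {R : Type*} [CommRing R] [IsLocalRing R]

theorem le_of_isFiniteLength_ker (hd : 1 ≤ ringKrullDim R) {a b : ℕ}
    (f : (Fin a → R) →ₗ[R] (Fin b → R)) (hker : IsFiniteLength R (LinearMap.ker f)) : a ≤ b := by
  obtain ⟨p, hp, hne⟩ := exists_isPrime_ne_maximalIdeal hd
  obtain ⟨s, hs, h0⟩ := hker.exists_notMem_smul_eq_zero hne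
  exact le_of_ker_locally_zero p f fun x hx => ⟨s, hs, congrArg Subtype.val (h0 ⟨x, hx⟩)⟩

/-- If `R ^ a → R ^ b → R ^ c` is exact, `a = b` and the kernel of the first map has finite length,
then so has the image of the second. -/
theorem isFiniteLength_range_of_exact [IsNoetherianRing R] {a b c : ℕ} (hab : a = b)
    (f : (Fin a → R) →ₗ[R] (Fin b → R)) (g : (Fin b → R) →ₗ[R] (Fin c → R))
    (hfg : Function.Exact f g) (hker : IsFiniteLength R (LinearMap.ker f)) :
    IsFiniteLength R (LinearMap.range g) := by
  subst hab
  refine isFiniteLength_of_locally_zero fun p hp hne x => ?_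
  obtain ⟨_, y, rfl⟩ := x
  obtain ⟨s, hs, h0⟩ := hker.exists_notMem_smul_eq_zero hne
  -- The adjugate shows that `det f` kills `coker f`, which is the image of `g` by exactness.
  have hD : LinearMap.det f • g y = 0 := by
    rw [← map_smul]
    exact (hfg _).2 (det_smul_mem_range f y)
  have hj (j) := exists_notMem_mul_eq_zero_of_det_mul_eq_zero p f
    (fun x hx => ⟨s, hs, congrArg Subtype.val (h0 ⟨x, hx⟩)⟩) (r := g y j) (congrFun hD j)
  obtain ⟨u, hu, hu0⟩ := exists_notMem_smul_eq_zero_of_algebraMap_eq_zero p (g y) fun j => by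
    obtain ⟨u, hu, hu0⟩ := hj j
    exact (IsLocalization.map_eq_zero_iff p.primeCompl _ _).2 ⟨⟨u, hu⟩, hu0⟩
  exact ⟨u, hu, Subtype.ext hu0⟩

/-- A nonzero module of finite length with a presentation by a matrix over the maximal ideal whose
kernel has finite length forces the dimension to be at most one. -/
theorem ringKrullDim_le_one_of_presentation [IsNoetherianRing R] (hd : 1 ≤ ringKrullDim R) {M : Type*} [AddCommGroup M]
    [Module R M] [Nontrivial M] (hM : IsFiniteLength R M) {a b : ℕ}
    (f : (Fin a → R) →ₗ[R] (Fin b → R)) (ε : (Fin b → R) →ₗ[R] M) (hε : Function.Surjective ε)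
    (hfε : Function.Exact f ε) (hmin : ∀ x j, f x j ∈ maximalIdeal R)
    (hker : IsFiniteLength R (LinearMap.ker f)) : ringKrullDim R ≤ 1 := by
  -- As `M` vanishes at `p`, some `s ∉ p` pushes the standard basis into the image of `f`; lifting
  -- it gives a right inverse of `f` up to `s`.
  have key (p : Ideal R) (hp : p.IsPrime) (hne : p ≠ maximalIdeal R) :
      ∃ (s : R) (g : (Fin b → R) →ₗ[R] (Fin a → R)), s ∉ p ∧ f ∘ₗ g = s • LinearMap.id := by
    obtain ⟨s, hs, h0⟩ := hM.exists_notMem_smul_eq_zero hne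
    have hex (j : Fin b) : ∃ x, f x = s • Pi.single j 1 :=
      (hfε _).1 (by rw [map_smul, h0])
    choose x hx using hex
    refine ⟨s, Fintype.linearCombination R x, hs, LinearMap.pi_ext' fun j => ?_⟩
    ext : 1
    simp [hx]
  have hab : a = b := by
    refine (le_of_isFiniteLength_ker hd f hker).antisymm ?_
    obtain ⟨p, hp, hne⟩ := exists_isPrime_ne_maximalIdeal hd
    obtain ⟨s, g, hs, hg⟩ := key p hp hne
    refine le_of_ker_locally_zero p g fun x hx => ⟨s, hs, ?_⟩
    have := LinearMap.congr_fun hg x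
    simpa [hx] using this.symm
  subst hab
  -- A unit determinant would make `f` surjective and `M` zero.
  have hDm : LinearMap.det f ∈ maximalIdeal R := by
    rw [mem_maximalIdeal, mem_nonunits_iff, ← LinearMap.isUnit_iff_isUnit_det]
    intro hu
    have hsurj := ((Module.End.isUnit_iff f).1 hu).2
    obtain ⟨m, hm⟩ := exists_ne (0 : M)
    obtain ⟨y, rfl⟩ := hε m
    exact hm ((hfε y).2 (hsurj y))
  have hmin : maximalIdeal R ∈ (Ideal.span {LinearMap.det f}).minimalPrimes := by
    refine ⟨⟨inferInstance, (Ideal.span_singleton_le_iff_mem _).2 hDm⟩, fun q ⟨hq, hDq⟩ _ => ?_⟩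
    by_contra hne
    obtain ⟨s, g, hs, hg⟩ := key q hq fun e => hne e.ge
    -- `det f * det g` is a power of `s ∉ q`, so `det f` avoids every nonmaximal prime `q`.
    have hdet := congrArg LinearMap.det hg
    rw [LinearMap.det_comp, LinearMap.det_smul, LinearMap.det_id, mul_one] at hdet
    refine hs (hq.mem_of_pow_mem _ (hdet ▸ q.mul_mem_right _ ?_))
    exact (Ideal.span_singleton_le_iff_mem _).1 hDq
  rw [← IsLocalRing.maximalIdeal_height_eq_ringKrullDim]
  exact_mod_cast Ideal.height_le_one_of_isPrincipal_of_mem_minimalPrimes _ _ hmin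

end PuncturedSpectrum

/-! ### Syzygies of finite length in a minimal resolution. -/

namespace MinimalFreeResolution

variable {R : Type*} [CommRing R] [IsLocalRing R] {M : Type*} [AddCommGroup M] [Module R M]
  (G : MinimalFreeResolution R M)

/-- Otherwise the nonzero free module covering `M`, an extension of `M` by this syzygy, would have
finite length, and so would `R`. -/
theorem not_isFiniteLength_range_zero (hd : 1 ≤ ringKrullDim R) [Nontrivial M]
    (hM : IsFiniteLength R M) : ¬ IsFiniteLength R (LinearMap.range (G.d 0)) := by
  intro h
  have hb : G.b 0 ≠ 0 := by
    intro hb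
    have : IsEmpty (Fin (G.b 0)) := by rw [hb]; infer_instance
    have := G.surjective_ε.subsingleton
    exact not_subsingleton M this
  rw [← LinearMap.exact_iff.1 G.exact_zero] at h
  have hfree : IsFiniteLength R (Fin (G.b 0) → R) := by
    rw [← Module.length_ne_top_iff] at h hM ⊢
    rw [Module.length_eq_add_of_exact (LinearMap.ker G.ε).subtype G.ε
      (Submodule.subtype_injective _) G.surjective_ε (LinearMap.exact_subtype_ker_map _)]
    exact WithTop.add_ne_top.2 ⟨h, hM⟩
  exact not_isFiniteLength_self hd
    (hfree.of_surjective (LinearMap.proj_surjective (⟨0, Nat.pos_of_ne_zero hb⟩ : Fin (G.b 0))))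

/-- The resolution cannot stop: by minimality the nonzero socle of each free term lies in the kernel
of the outgoing differential. Positivity is needed to cancel a Betti number later. -/
theorem b_pos [IsNoetherianRing R] (hd : 1 ≤ ringKrullDim R) (hdepth : localDepth R = 0)
    [Nontrivial M] (hM : IsFiniteLength R M) (i : ℕ) : 0 < G.b i := by
  induction i with
  | zero =>
    rw [Nat.pos_iff_ne_zero]
    intro hb
    have : IsEmpty (Fin (G.b 0)) := by rw [hb]; infer_instance
    have := G.surjective_ε.subsingleton
    exact not_subsingleton M this
  | succ i ih =>
    rw [Nat.pos_iff_ne_zero]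
    intro hb
    have : IsEmpty (Fin (G.b (i + 1))) := by rw [hb]; infer_instance
    have hbot : LinearMap.range (G.d i) = ⊥ := by
      rw [LinearMap.range_eq_bot]; exact Subsingleton.elim _ _
    cases i with
    | zero =>
      refine G.not_isFiniteLength_range_zero hd hM ?_
      rw [hbot]
      exact .of_subsingleton
    | succ i =>
      obtain ⟨x, hx, hx0⟩ := exists_mem_localSocle_ne_zero hdepth
      have h0 : (fun _ => x : Fin (G.b (i + 1)) → R) ∈ LinearMap.ker (G.d i) :=
        map_eq_zero_of_mem_localSocle _ (G.minimal i) fun _ => hx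
      rw [LinearMap.exact_iff.1 (G.exact_succ i), hbot, Submodule.mem_bot] at h0
      exact hx0 (congrFun h0 ⟨0, ih⟩)

theorem isFiniteLength_ker_of_range_succ {i : ℕ}
    (h : IsFiniteLength R (LinearMap.range (G.d (i + 1)))) :
    IsFiniteLength R (LinearMap.ker (G.d i)) := by
  rwa [LinearMap.exact_iff.1 (G.exact_succ i)]

/-- Since `λ(H⁰_𝔪(R)) = t + l`, the finite term `b_{i+2} l` cancels from the length count. The index
starts at 2 because `d i` must exist to kill the socle of the target of `d (i + 1)`. -/
theorem b_mul_socleDim_le [IsNoetherianRing R] {i : ℕ}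
    (h : IsFiniteLength R (LinearMap.range (G.d (i + 2)))) :
    (G.b (i + 1) : ℕ∞) * socleDim R ≤ G.b (i + 2) * socleDefect R := by
  have hlen := length_localSocle_mul_le (G.d (i + 1)) (G.isFiniteLength_ker_of_range_succ h)
    (fun x hx => map_eq_zero_of_mem_localSocle _ (G.minimal _) hx)
    (fun y hy => (G.exact_succ i y).1 (map_eq_zero_of_mem_localSocle _ (G.minimal _) hy))
  rw [length_localH0_eq, length_localSocle, mul_add, add_comm] at hlen
  exact (ENat.add_le_add_iff_right (by exact_mod_cast ENat.natCast_ne_top _)).1 hlen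

/-- Finite length of a syzygy module of index at least three bounds `Soc R`. -/
theorem socleDim_le_socleDefect [IsNoetherianRing R] (hd : 1 ≤ ringKrullDim R)
    (hdepth : localDepth R = 0) [Nontrivial M] (hM : IsFiniteLength R M) {i : ℕ}
    (h : IsFiniteLength R (LinearMap.range (G.d (i + 2)))) :
    (socleDim R : ℕ∞) ≤ socleDefect R := by
  have h1 := G.b_mul_socleDim_le h
  have h2 := le_of_isFiniteLength_ker hd _ (G.isFiniteLength_ker_of_range_succ h)
  have h3 := G.b_pos hd hdepth hM (i + 1)
  have h4 : (G.b (i + 1) : ℕ∞) * socleDim R ≤ G.b (i + 1) * socleDefect R :=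
    h1.trans (by gcongr)
  exact (ENat.mul_le_mul_left_iff (by exact_mod_cast h3.ne') (ENat.natCast_ne_top _)).1 h4

/-- With `t ≤ l` and `l > 0`, the length count reverses the rank inequality, so `d (i + 1)` is
square and the determinant argument applies. -/
theorem isFiniteLength_range_of_add_two [IsNoetherianRing R] (hd : 1 ≤ ringKrullDim R)
    (hdepth : localDepth R = 0) (ht : socleDefect R ≤ socleDim R) {i : ℕ}
    (h : IsFiniteLength R (LinearMap.range (G.d (i + 2)))) :
    IsFiniteLength R (LinearMap.range (G.d i)) := by
  have hker := G.isFiniteLength_ker_of_range_succ h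
  have h1 : (G.b (i + 1) : ℕ∞) * socleDim R ≤ G.b (i + 2) * socleDim R :=
    (G.b_mul_socleDim_le h).trans (by gcongr)
  have h2 : G.b (i + 1) ≤ G.b (i + 2) :=
    Nat.le_of_mul_le_mul_right (by exact_mod_cast h1) (socleDim_pos hdepth)
  exact isFiniteLength_range_of_exact ((le_of_isFiniteLength_ker hd _ hker).antisymm h2) _ _
    (G.exact_succ i) hker

end MinimalFreeResolution

theorem mainTheorem7 (R : Type*) [CommRing R] [IsLocalRing R] [IsNoetherianRing R]
    (d : ℕ) (hd : ringKrullDim R = d) (hd1 : 1 ≤ d) (hdepth : localDepth R = 0)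
    (M : Type*) [AddCommGroup M] [Module R M] [Nontrivial M] (hM : IsFiniteLength R M)
    (G : MinimalFreeResolution R M) :
    (d = 1 → socleDefect R < (socleDim R : ℕ∞) →
      ∀ i : ℕ, 0 < i → i ≠ 2 → Module.length R (G.syz i) = ⊤) ∧
    (2 ≤ d → socleDefect R ≤ (socleDim R : ℕ∞) →
      ∀ i : ℕ, 0 < i → Module.length R (G.syz i) = ⊤) := by
  have hdim : 1 ≤ ringKrullDim R := by rw [hd]; exact_mod_cast hd1
  have hzero := G.not_isFiniteLength_range_zero hdim hM
  refine ⟨fun _ ht i hi hi2 => ?_, fun hd2 ht i hi => ?_⟩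
  · by_contra hne
    have h : IsFiniteLength R (G.syz i) := Module.length_ne_top_iff.1 hne
    match i, hi, hi2, h with
    | 1, _, _, h => exact hzero h
    | i + 3, _, _, h => exact ht.not_ge (G.socleDim_le_socleDefect hdim hdepth hM h)
  · suffices ∀ j, ¬ IsFiniteLength R (LinearMap.range (G.d j)) by
      by_contra hne
      exact this (i - 1) (Module.length_ne_top_iff.1 hne)
    intro j
    -- Finite length descends by two indices, so `Syz_1` and `Syz_2` are the base cases; only
    -- `Syz_2` uses `d ≥ 2`.
    induction j using Nat.twoStepInduction with
    | zero => exact hzero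
    | one =>
      intro h
      have := ringKrullDim_le_one_of_presentation hdim hM (G.d 0) G.ε G.surjective_ε G.exact_zero
        (G.minimal 0) (G.isFiniteLength_ker_of_range_succ h)
      rw [hd] at this
      exact absurd (hd2.trans (by exact_mod_cast this : d ≤ 1)) (by decide)
    | more j ih _ => exact fun h => ih (G.isFiniteLength_range_of_add_two hdim hdepth ht h)
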